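/- Let $n\ge 1$ and let $L_n$ be the path graph with vertices $1,\dots,n$ and edges $\{j,j+1\}$ for $1\le j\le n-1$, with its path distance $d$. A doubling measure $\mu$ on $L_n$ is given by weights $\mu(j)>0$ (on a finite graph all of these are doubling), with $\mu(A)=\sum_{j\in A}\mu(j)$. Put $$C_\mu=\sup_{1\le x\le n,\ r>0}\frac{\mu(\{y:d(x,y)<2r\})}{\mu(\{y:d(x,y)<r\})},\qquad C^0_\mu=\sup_{1\le x\le n}\frac{\mu(\{y:d(x,y)\le 1\})}{\mu(x)},$$ and $C_{L_n}=\inf_\mu C_\mu$, $C^0_{L_n}=\inf_\mu C^0_\mu$, the infima being taken over all doubling measures on $L_n$. Then, for every $n\ge 1$, $$C^0_{L_n}=1+2\cos\Big(\frac{\pi}{n+1}\Big)\le C_{L_n}<3,$$ and moreover $C^0_{L_n}=C_{L_n}$ if and only if $n\le 8$. -/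

import Mathlib

noncomputable section

namespace GraphDoubling

variable {V : Type*} [Fintype V]

/-- The mass `μ(B(x, r))` of the open ball `B(x, r) = {y : d_G(x, y) < r}` for the path distance of
the finite connected graph `G`, where `μ` is the measure with weights `μ v` at the vertices. -/
def openBallMass (G : SimpleGraph V) (μ : V → ℝ) (x : V) (r : ℝ) : ℝ :=
  ∑ y with (G.dist x y : ℝ) < r, μ y

/-- The mass of the closed unit ball `{y : d_G(x, y) ≤ 1}`. -/
def closedUnitBallMass (G : SimpleGraph V) (μ : V → ℝ) (x : V) : ℝ :=
  ∑ y with G.dist x y ≤ 1, μ y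

/-- All the quotients `μ(B(x, 2r)) / μ(B(x, r))`, with `x` a vertex and `r > 0` real. -/
def doublingQuotients (G : SimpleGraph V) (μ : V → ℝ) : Set ℝ :=
  {q | ∃ x : V, ∃ r : ℝ, 0 < r ∧ q = openBallMass G μ x (2 * r) / openBallMass G μ x r}

/-- `μ` is a doubling measure on `G`: all the weights are positive, and the quotients
`μ(B(x, 2r)) / μ(B(x, r))` are bounded. -/
def IsDoubling (G : SimpleGraph V) (μ : V → ℝ) : Prop :=
  (∀ v, 0 < μ v) ∧ BddAbove (doublingQuotients G μ)

/-- The doubling constant `C_μ = sup_{x, r > 0} μ(B(x, 2r)) / μ(B(x, r))`. -/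
def doublingConst (G : SimpleGraph V) (μ : V → ℝ) : ℝ :=
  sSup (doublingQuotients G μ)

/-- The constant `C_μ^0 = sup_x μ({y : d_G(x, y) ≤ 1}) / μ(x)`. -/
def doublingConst₀ (G : SimpleGraph V) (μ : V → ℝ) : ℝ :=
  sSup {q | ∃ x : V, q = closedUnitBallMass G μ x / μ x}

/-- The least doubling constant `C_G = inf_μ C_μ`, over the doubling measures on `G`. -/
def leastDoublingConst (G : SimpleGraph V) : ℝ :=
  sInf {c | ∃ μ : V → ℝ, IsDoubling G μ ∧ c = doublingConst G μ}

/-- The constant `C_G^0 = inf_μ C_μ^0`, over the doubling measures on `G`. -/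
def leastDoublingConst₀ (G : SimpleGraph V) : ℝ :=
  sInf {c | ∃ μ : V → ℝ, IsDoubling G μ ∧ c = doublingConst₀ G μ}

/-- On a finite graph every measure with positive weights is doubling. -/
theorem isDoubling_of_pos (G : SimpleGraph V) (μ : V → ℝ) (hμ : ∀ v, 0 < μ v) :
    IsDoubling G μ := by
  refine ⟨hμ, ∑ x, (∑ y, μ y) / μ x, ?_⟩
  rintro q ⟨x, r, hr, rfl⟩
  have h1 : openBallMass G μ x (2 * r) ≤ ∑ y, μ y :=
    Finset.sum_le_sum_of_subset_of_nonneg (Finset.filter_subset _ _) fun y _ _ => (hμ y).le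
  have h2 : μ x ≤ openBallMass G μ x r :=
    Finset.single_le_sum (f := μ) (fun y _ => (hμ y).le) (by simp [hr])
  have h0 : 0 ≤ ∑ y, μ y := Finset.sum_nonneg fun y _ => (hμ y).le
  calc openBallMass G μ x (2 * r) / openBallMass G μ x r ≤ (∑ y, μ y) / μ x :=
        div_le_div₀ h0 h1 (hμ x) h2
    _ ≤ ∑ x, (∑ y, μ y) / μ x :=
        Finset.single_le_sum (f := fun x => (∑ y, μ y) / μ x)
          (fun z _ => div_nonneg h0 (hμ z).le) (Finset.mem_univ x)

end GraphDoubling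

end

/-! With θ = π/(n+1), the sine vector is a positive eigenvector of the self-adjoint unit ball
operator, with eigenvalue c = 1 + 2 cos θ. Pairing it with any μ gives the Collatz–Wielandt bound
`eigenvalue_le_of_closedBallMass_one_le`; radius one then gives c as a lower bound for both
constants, and the sine measure attains it for the unit-ball constant. A small sine perturbation of
the uniform measure brings all quotients below 3.

The threshold comes from the ball of radius 1 at an endpoint. For an eigenvector a, c(a 0 + a 1) = 2
a 0 + 2 a 1 + a 2, so doubling there says a 3 ≤ a 0 + a 1. For sines this is 2 cos 3θ ≤ 1, that is θ
≥ π/9, or n ≤ 8. In that range the sine measure passes every other test (`sum_Ico_le_of_le_eight`).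
For n ≥ 9, equality would give by compactness a limit measure with constant c; the extremal case
makes it an eigenvector, and the endpoint test fails. -/

noncomputable section

namespace GraphDoubling

/-! ### Reduction to closed balls of integer radius. -/

section General

variable {V : Type*} [Fintype V] {G : SimpleGraph V} {μ : V → ℝ}

/-- The mass of the closed ball `{y : d_G(x, y) ≤ k}`. -/
def closedBallMass (G : SimpleGraph V) (μ : V → ℝ) (x : V) (k : ℕ) : ℝ :=
  ∑ y with G.dist x y ≤ k, μ y

theorem closedBallMass_mono (hμ : ∀ v, 0 ≤ μ v) (x : V) {k l : ℕ} (h : k ≤ l) :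
    closedBallMass G μ x k ≤ closedBallMass G μ x l := by
  refine Finset.sum_le_sum_of_subset_of_nonneg ?_ fun y _ _ => hμ y
  intro y
  simp only [Finset.mem_filter, Finset.mem_univ, true_and]
  omega

theorem apply_le_closedBallMass (hμ : ∀ v, 0 ≤ μ v) {x y : V} {k : ℕ} (h : G.dist x y ≤ k) :
    μ y ≤ closedBallMass G μ x k :=
  Finset.single_le_sum (f := μ) (fun y _ => hμ y) (by simpa using h)

theorem closedBallMass_le_sum (hμ : ∀ v, 0 ≤ μ v) (x : V) (k : ℕ) :
    closedBallMass G μ x k ≤ ∑ y, μ y :=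
  Finset.sum_le_sum_of_subset_of_nonneg (Finset.filter_subset _ _) fun y _ _ => hμ y

theorem closedBallMass_pos (hμ : ∀ v, 0 < μ v) (x : V) (k : ℕ) :
    0 < closedBallMass G μ x k :=
  (hμ x).trans_le (apply_le_closedBallMass (fun v => (hμ v).le) (by simp))

theorem openBallMass_eq (x : V) (k : ℕ) {r : ℝ} (h1 : (k : ℝ) < r) (h2 : r ≤ k + 1) :
    openBallMass G μ x r = closedBallMass G μ x k := by
  unfold openBallMass closedBallMass
  congr 1
  ext y
  simp only [Finset.mem_filter, Finset.mem_univ, true_and]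
  constructor
  · intro h
    have : ((G.dist x y : ℕ) : ℝ) < ((k + 1 : ℕ) : ℝ) := by push_cast; linarith
    exact Nat.lt_succ_iff.mp (Nat.cast_lt.mp this)
  · intro h
    have : ((G.dist x y : ℕ) : ℝ) ≤ (k : ℝ) := Nat.cast_le.mpr h
    linarith

theorem exists_nat_lt_le {r : ℝ} (hr : 0 < r) : ∃ k : ℕ, (k : ℝ) < r ∧ r ≤ k + 1 := by
  have h0 : 0 < ⌈r⌉₊ := Nat.ceil_pos.mpr hr
  obtain ⟨k, hk⟩ : ∃ k, ⌈r⌉₊ = k + 1 := ⟨⌈r⌉₊ - 1, by omega⟩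
  refine ⟨k, Nat.lt_ceil.mp (by omega), ?_⟩
  have := Nat.le_ceil r
  rw [hk] at this
  exact_mod_cast this

/-- For k < r ≤ k + 1 the denominator is fixed while the numerator is largest at r = k + 1, where
the open ball of radius 2k + 2 is the closed one of radius 2k + 1. -/
theorem doublingQuotient_le_closedBallMass_div (hμ : ∀ v, 0 < μ v) {q : ℝ}
    (hq : q ∈ doublingQuotients G μ) :
    ∃ x k, q ≤ closedBallMass G μ x (2 * k + 1) / closedBallMass G μ x k := by
  obtain ⟨x, r, hr, rfl⟩ := hq
  obtain ⟨k, hk1, hk2⟩ := exists_nat_lt_le hr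
  obtain ⟨l, hl1, hl2⟩ := exists_nat_lt_le (by linarith : 0 < 2 * r)
  refine ⟨x, k, ?_⟩
  rw [openBallMass_eq x k hk1 hk2, openBallMass_eq x l hl1 hl2]
  have hlk : l ≤ 2 * k + 1 := by
    have : (l : ℝ) < ((2 * k + 2 : ℕ) : ℝ) := by push_cast; linarith
    have := Nat.cast_lt.mp this
    omega
  exact div_le_div_of_nonneg_right (closedBallMass_mono (fun v => (hμ v).le) x hlk)
    (closedBallMass_pos hμ x k).le

theorem closedBallMass_le_doublingConst_mul (hμ : ∀ v, 0 < μ v) (x : V) (k : ℕ) :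
    closedBallMass G μ x (2 * k + 1) ≤ doublingConst G μ * closedBallMass G μ x k := by
  rw [← div_le_iff₀ (closedBallMass_pos hμ x k)]
  refine le_csSup (isDoubling_of_pos G μ hμ).2 ⟨x, (k : ℝ) + 1, by positivity, ?_⟩
  rw [openBallMass_eq x k (by linarith) le_rfl,
    openBallMass_eq x (2 * k + 1) (by push_cast; linarith) (by push_cast; linarith)]

theorem doublingQuotients_nonempty [Nonempty V] : (doublingQuotients G μ).Nonempty :=
  ⟨_, Classical.arbitrary V, 1, one_pos, rfl⟩

theorem doublingConst_le [Nonempty V] (hμ : ∀ v, 0 < μ v) {c : ℝ}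
    (h : ∀ x k, closedBallMass G μ x (2 * k + 1) ≤ c * closedBallMass G μ x k) :
    doublingConst G μ ≤ c := by
  refine csSup_le doublingQuotients_nonempty fun q hq => ?_
  obtain ⟨x, k, hq⟩ := doublingQuotient_le_closedBallMass_div hμ hq
  exact hq.trans ((div_le_iff₀ (closedBallMass_pos hμ x k)).mpr (h x k))

/-- Numerators and denominators are subset sums. Finiteness makes the supremum a maximum, so strict
bounds survive in `doublingConst_lt`. -/
theorem finite_doublingQuotients : (doublingQuotients G μ).Finite := by
  have hfin : (Set.range fun s : Finset V × Finset V =>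
      (∑ y ∈ s.1, μ y) / ∑ y ∈ s.2, μ y).Finite := Set.finite_range _
  refine hfin.subset ?_
  rintro q ⟨x, r, -, rfl⟩
  exact ⟨(_, _), rfl⟩

theorem doublingConst_lt [Nonempty V] (hμ : ∀ v, 0 < μ v) {c : ℝ}
    (h : ∀ x k, closedBallMass G μ x (2 * k + 1) < c * closedBallMass G μ x k) :
    doublingConst G μ < c := by
  refine (finite_doublingQuotients.csSup_lt_iff doublingQuotients_nonempty).mpr fun q hq => ?_
  obtain ⟨x, k, hq⟩ := doublingQuotient_le_closedBallMass_div hμ hq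
  exact hq.trans_lt ((div_lt_iff₀ (closedBallMass_pos hμ x k)).mpr (h x k))

theorem closedBallMass_one_le_doublingConst₀_mul (hμ : ∀ v, 0 < μ v) (x : V) :
    closedBallMass G μ x 1 ≤ doublingConst₀ G μ * μ x := by
  rw [← div_le_iff₀ (hμ x)]
  have hfin : {q | ∃ x : V, q = closedUnitBallMass G μ x / μ x}.Finite := by
    refine (Set.finite_range fun x => closedUnitBallMass G μ x / μ x).subset ?_
    rintro q ⟨x, rfl⟩
    exact ⟨x, rfl⟩
  exact le_csSup hfin.bddAbove ⟨x, rfl⟩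

theorem doublingConst₀_le [Nonempty V] (hμ : ∀ v, 0 < μ v) {c : ℝ}
    (h : ∀ x, closedBallMass G μ x 1 ≤ c * μ x) : doublingConst₀ G μ ≤ c := by
  refine csSup_le ⟨_, Classical.arbitrary V, rfl⟩ ?_
  rintro q ⟨x, rfl⟩
  exact (div_le_iff₀ (hμ x)).mpr (h x)

theorem closedBallMass_zero (hG : G.Preconnected) (x : V) : closedBallMass G μ x 0 = μ x := by
  unfold closedBallMass
  rw [Finset.sum_eq_single x]
  · intro y hy hyx
    simp only [Finset.mem_filter, Finset.mem_univ, true_and, Nat.le_zero] at hy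
    exact absurd (((hG x y).dist_eq_zero_iff).mp hy).symm hyx
  · simp

/-! ### Self-adjointness and the Collatz–Wielandt bound. -/

/-- The closed ball operator is self-adjoint. -/
theorem sum_mul_closedBallMass_comm (s μ : V → ℝ) (k : ℕ) :
    ∑ x, s x * closedBallMass G μ x k = ∑ x, μ x * closedBallMass G s x k := by
  simp only [closedBallMass, Finset.sum_filter, Finset.mul_sum]
  rw [Finset.sum_comm]
  refine Finset.sum_congr rfl fun x _ => Finset.sum_congr rfl fun y _ => ?_
  rw [SimpleGraph.dist_comm]
  split_ifs <;> ring

theorem closedBallMass_add_smul (μ ν : V → ℝ) (c : ℝ) (x : V) (k : ℕ) :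
    closedBallMass G (fun v => μ v + c * ν v) x k
      = closedBallMass G μ x k + c * closedBallMass G ν x k := by
  simp only [closedBallMass, Finset.sum_add_distrib, Finset.mul_sum]

theorem closedBallMass_mul_left (ν : V → ℝ) (c : ℝ) (x : V) (k : ℕ) :
    closedBallMass G (fun v => c * ν v) x k = c * closedBallMass G ν x k := by
  simp only [closedBallMass, Finset.mul_sum]

/-- Collatz–Wielandt: a positive eigenvector of the closed unit ball operator bounds the
constants `c` with `μ(B(x, 1)) ≤ c μ(x)` from below by its eigenvalue. -/
theorem eigenvalue_le_of_closedBallMass_one_le [Nonempty V] {s : V → ℝ} {a c : ℝ}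
    (hs : ∀ v, 0 < s v) (hsa : ∀ x, closedBallMass G s x 1 = a * s x)
    (hμ : ∀ v, 0 < μ v) (h : ∀ x, closedBallMass G μ x 1 ≤ c * μ x) : a ≤ c := by
  have hpos : 0 < ∑ x, s x * μ x :=
    Finset.sum_pos (fun x _ => mul_pos (hs x) (hμ x)) Finset.univ_nonempty
  refine le_of_mul_le_mul_right ?_ hpos
  calc a * ∑ x, s x * μ x = ∑ x, μ x * closedBallMass G s x 1 := by
        rw [Finset.mul_sum]
        refine Finset.sum_congr rfl fun x _ => ?_
        rw [hsa]; ring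
    _ = ∑ x, s x * closedBallMass G μ x 1 := (sum_mul_closedBallMass_comm s μ 1).symm
    _ ≤ ∑ x, s x * (c * μ x) :=
        Finset.sum_le_sum fun x _ => mul_le_mul_of_nonneg_left (h x) (hs x).le
    _ = c * ∑ x, s x * μ x := by
        rw [Finset.mul_sum]
        exact Finset.sum_congr rfl fun x _ => by ring

/-- In the extremal case of the Collatz–Wielandt bound, `μ` is itself an eigenvector. -/
theorem closedBallMass_one_eq_of_le {s : V → ℝ} {a : ℝ}
    (hs : ∀ v, 0 < s v) (hsa : ∀ x, closedBallMass G s x 1 = a * s x)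
    (h : ∀ x, closedBallMass G μ x 1 ≤ a * μ x) (x : V) :
    closedBallMass G μ x 1 = a * μ x := by
  have hsum : ∑ x, s x * closedBallMass G μ x 1 = ∑ x, s x * (a * μ x) := by
    rw [sum_mul_closedBallMass_comm s μ 1]
    refine Finset.sum_congr rfl fun x _ => ?_
    rw [hsa]; ring
  have := (Finset.sum_eq_sum_iff_of_le fun x _ =>
    mul_le_mul_of_nonneg_left (h x) (hs x).le).mp hsum x (Finset.mem_univ x)
  exact mul_left_cancel₀ (hs x).ne' this

/-! ### Infima over measures and a limiting minimizer. -/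

theorem doublingConst_nonneg (hμ : ∀ v, 0 < μ v) : 0 ≤ doublingConst G μ := by
  refine Real.sSup_nonneg ?_
  rintro q ⟨x, r, -, rfl⟩
  exact div_nonneg (Finset.sum_nonneg fun y _ => (hμ y).le)
    (Finset.sum_nonneg fun y _ => (hμ y).le)

theorem doublingConst₀_nonneg (hμ : ∀ v, 0 < μ v) : 0 ≤ doublingConst₀ G μ := by
  refine Real.sSup_nonneg ?_
  rintro q ⟨x, rfl⟩
  exact div_nonneg (Finset.sum_nonneg fun y _ => (hμ y).le) (hμ x).le

theorem leastDoublingConst_le (hμ : ∀ v, 0 < μ v) :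
    leastDoublingConst G ≤ doublingConst G μ := by
  refine csInf_le ⟨0, ?_⟩ ⟨μ, isDoubling_of_pos G μ hμ, rfl⟩
  rintro c ⟨ν, hν, rfl⟩
  exact doublingConst_nonneg hν.1

theorem leastDoublingConst₀_le (hμ : ∀ v, 0 < μ v) :
    leastDoublingConst₀ G ≤ doublingConst₀ G μ := by
  refine csInf_le ⟨0, ?_⟩ ⟨μ, isDoubling_of_pos G μ hμ, rfl⟩
  rintro c ⟨ν, hν, rfl⟩
  exact doublingConst₀_nonneg hν.1

theorem le_leastDoublingConst {c : ℝ} (h : ∀ μ : V → ℝ, (∀ v, 0 < μ v) → c ≤ doublingConst G μ) :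
    c ≤ leastDoublingConst G := by
  refine le_csInf ⟨_, fun _ => 1, isDoubling_of_pos G _ fun _ => one_pos, rfl⟩ ?_
  rintro _ ⟨μ, hμ, rfl⟩
  exact h μ hμ.1

theorem le_leastDoublingConst₀ {c : ℝ}
    (h : ∀ μ : V → ℝ, (∀ v, 0 < μ v) → c ≤ doublingConst₀ G μ) :
    c ≤ leastDoublingConst₀ G := by
  refine le_csInf ⟨_, fun _ => 1, isDoubling_of_pos G _ fun _ => one_pos, rfl⟩ ?_
  rintro _ ⟨μ, hμ, rfl⟩
  exact h μ hμ.1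

theorem exists_doublingConst_lt {c : ℝ} (h : leastDoublingConst G < c) :
    ∃ μ : V → ℝ, (∀ v, 0 < μ v) ∧ doublingConst G μ < c := by
  have hne : {c | ∃ μ : V → ℝ, IsDoubling G μ ∧ c = doublingConst G μ}.Nonempty :=
    ⟨_, fun _ => 1, isDoubling_of_pos G _ fun _ => one_pos, rfl⟩
  obtain ⟨_, ⟨μ, hμ, rfl⟩, hc⟩ := exists_lt_of_csInf_lt hne h
  exact ⟨μ, hμ.1, hc⟩

/-- The least doubling constant is attained by a probability vector, possibly with zeros. -/
theorem exists_mem_stdSimplex_closedBallMass_le [Nonempty V] :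
    ∃ ν ∈ stdSimplex ℝ V, ∀ x k,
      closedBallMass G ν x (2 * k + 1) ≤ leastDoublingConst G * closedBallMass G ν x k := by
  have key : ∀ m : ℕ, ∃ ν ∈ stdSimplex ℝ V, ∀ x k, closedBallMass G ν x (2 * k + 1)
      ≤ (leastDoublingConst G + 1 / ((m : ℝ) + 1)) * closedBallMass G ν x k := by
    intro m
    obtain ⟨μ, hμ, hc⟩ := exists_doublingConst_lt (G := G)
      (c := leastDoublingConst G + 1 / ((m : ℝ) + 1)) (by
        have : 0 < 1 / ((m : ℝ) + 1) := by positivity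
        linarith)
    have hT : 0 < ∑ y, μ y := Finset.sum_pos (fun x _ => hμ x) Finset.univ_nonempty
    refine ⟨fun v => (∑ y, μ y)⁻¹ * μ v, ⟨fun v => ?_, ?_⟩, fun x k => ?_⟩
    · exact mul_nonneg (inv_nonneg.mpr hT.le) (hμ v).le
    · rw [← Finset.mul_sum, inv_mul_cancel₀ hT.ne']
    · rw [closedBallMass_mul_left, closedBallMass_mul_left, mul_left_comm]
      refine mul_le_mul_of_nonneg_left ?_ (inv_nonneg.mpr hT.le)
      exact (closedBallMass_le_doublingConst_mul hμ x k).trans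
        (mul_le_mul_of_nonneg_right hc.le (closedBallMass_pos hμ x k).le)
  choose ν hν hνle using key
  -- Normalized near-minimizers subconverge. The inequalities are kept free of division because
  -- weights may vanish in the limit.
  obtain ⟨ρ, hρ, φ, hφ, hlim⟩ := (isCompact_stdSimplex ℝ V).tendsto_subseq hν
  refine ⟨ρ, hρ, fun x k => ?_⟩
  have hcont : ∀ l, Continuous fun μ : V → ℝ => closedBallMass G μ x l := fun l =>
    continuous_finsetSum _ fun y _ => continuous_apply y
  have h1 := ((hcont (2 * k + 1)).tendsto ρ).comp hlim
  have h2 := ((hcont k).tendsto ρ).comp hlim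
  have h3 := (tendsto_one_div_add_atTop_nhds_zero_nat (𝕜 := ℝ)).comp hφ.tendsto_atTop
  have h4 := (h3.const_add (leastDoublingConst G)).mul h2
  rw [add_zero] at h4
  exact le_of_tendsto_of_tendsto' h1 h4 fun m => hνle (φ m) x k

end General

/-! ### Balls in the path graph as intervals. -/

theorem pathGraph_le_add_length {n : ℕ} {x y : Fin n}
    (p : (SimpleGraph.pathGraph n).Walk x y) :
    (x : ℕ) ≤ y + p.length ∧ (y : ℕ) ≤ x + p.length := by
  induction p with
  | nil => simp
  | cons h p ih =>
    rw [SimpleGraph.pathGraph_adj] at h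
    rw [SimpleGraph.Walk.length_cons]
    omega

theorem pathGraph_exists_walk {n : ℕ} (k : ℕ) (x y : Fin n) (h : (x : ℕ) + k = y) :
    ∃ p : (SimpleGraph.pathGraph n).Walk x y, p.length = k := by
  induction k generalizing x with
  | zero =>
    obtain rfl : x = y := Fin.ext (by omega)
    exact ⟨.nil, rfl⟩
  | succ k ih =>
    have hlt : (x : ℕ) + 1 < n := by omega
    obtain ⟨p, hp⟩ := ih ⟨x + 1, hlt⟩ (by simp only; omega)
    refine ⟨.cons (SimpleGraph.pathGraph_adj.mpr (Or.inl rfl)) p, ?_⟩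
    rw [SimpleGraph.Walk.length_cons, hp]

theorem pathGraph_dist_le_iff {n : ℕ} (x y : Fin n) (k : ℕ) :
    (SimpleGraph.pathGraph n).dist x y ≤ k ↔ (x : ℕ) ≤ y + k ∧ (y : ℕ) ≤ x + k := by
  constructor
  · intro h
    obtain ⟨p, hp⟩ := (SimpleGraph.pathGraph_preconnected n x y).exists_walk_length_eq_dist
    have := pathGraph_le_add_length p
    omega
  · rintro ⟨h1, h2⟩
    rcases le_total (x : ℕ) y with h | h
    · obtain ⟨p, hp⟩ := pathGraph_exists_walk (y - x : ℕ) x y (by omega)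
      exact (SimpleGraph.dist_le p).trans (by omega)
    · obtain ⟨p, hp⟩ := pathGraph_exists_walk (x - y : ℕ) y x (by omega)
      rw [SimpleGraph.dist_comm]
      exact (SimpleGraph.dist_le p).trans (by omega)

theorem closedBallMass_pathGraph {n : ℕ} {μ : Fin n → ℝ} {f : ℕ → ℝ} (hf : ∀ y, μ y = f y)
    (x : Fin n) (k : ℕ) :
    closedBallMass (SimpleGraph.pathGraph n) μ x k
      = ∑ j ∈ Finset.Ico ((x : ℕ) - k) (min (x + k + 1) n), f j := by
  have h1 : closedBallMass (SimpleGraph.pathGraph n) μ x k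
      = ∑ y : Fin n, (fun j : ℕ => if (x : ℕ) ≤ j + k ∧ j ≤ x + k then f j else 0) y := by
    simp only [closedBallMass, pathGraph_dist_le_iff, Finset.sum_filter, hf]
  rw [h1, Fin.sum_univ_eq_sum_range (fun j : ℕ => if (x : ℕ) ≤ j + k ∧ j ≤ x + k then f j else 0) n,
    ← Finset.sum_filter]
  congr 1
  ext j
  simp only [Finset.mem_filter, Finset.mem_range, Finset.mem_Ico]
  omega

/-- The uniform measure has doubling quotients at most `3`, with strict inequality for radius at
least one. -/
theorem closedBallMass_pathGraph_one_le {n : ℕ} (x : Fin n) (k : ℕ) :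
    closedBallMass (SimpleGraph.pathGraph n) (fun _ => 1) x (2 * k + 1) + (if k = 0 then 0 else 1)
      ≤ 3 * closedBallMass (SimpleGraph.pathGraph n) (fun _ => 1) x k := by
  rw [closedBallMass_pathGraph (f := fun _ => 1) (fun _ => rfl),
    closedBallMass_pathGraph (f := fun _ => 1) (fun _ => rfl)]
  simp only [Finset.sum_const, Nat.card_Ico, nsmul_eq_mul, mul_one]
  have hx := x.2
  split_ifs with h
  · norm_cast
    omega
  · norm_cast
    omega

/-! ### The sine eigenvector. -/

/-- The eigenvector `j ↦ sin ((j + 1) π / (n + 1))` of the path graph. -/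
def sineWeight (n : ℕ) (j : ℕ) : ℝ :=
  Real.sin (((j : ℝ) + 1) * (Real.pi / ((n : ℝ) + 1)))

theorem sineWeight_pos {n j : ℕ} (h : j < n) : 0 < sineWeight n j := by
  have hj : (j : ℝ) < n := Nat.cast_lt.mpr h
  have hn : (0 : ℝ) < (n : ℝ) + 1 := by positivity
  refine Real.sin_pos_of_pos_of_lt_pi (by positivity) ?_
  rw [mul_div_assoc', div_lt_iff₀ hn]
  nlinarith [Real.pi_pos]

theorem sineWeight_le_one (n j : ℕ) : sineWeight n j ≤ 1 := Real.sin_le_one _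

theorem sineWeight_symm {n i j : ℕ} (h : i + j + 1 = n) : sineWeight n i = sineWeight n j := by
  unfold sineWeight
  rw [← Real.sin_pi_sub]
  congr 1
  subst h
  push_cast
  field_simp
  ring

theorem sineWeight_mono {n i j : ℕ} (hij : i ≤ j) (h : 2 * j + 1 ≤ n) :
    sineWeight n i ≤ sineWeight n j := by
  have h1 : (i : ℝ) ≤ j := Nat.cast_le.mpr hij
  have h2 : 2 * (j : ℝ) + 1 ≤ n := by exact_mod_cast h
  have hn : (0 : ℝ) < (n : ℝ) + 1 := by positivity
  refine Real.sin_le_sin_of_le_of_le_pi_div_two ?_ ?_ (by gcongr)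
  · have : 0 ≤ ((i : ℝ) + 1) * (Real.pi / ((n : ℝ) + 1)) := by positivity
    linarith [Real.pi_pos]
  · rw [mul_div_assoc', div_le_iff₀ hn]
    nlinarith [Real.pi_pos]

theorem sineWeight_last (n : ℕ) : sineWeight n n = 0 := by
  unfold sineWeight
  rw [mul_div_cancel₀ _ (by positivity), Real.sin_pi]

theorem sineWeight_zero_add_one (n : ℕ) :
    sineWeight n 0 + sineWeight n 1
      = (1 + 2 * Real.cos (Real.pi / ((n : ℝ) + 1))) * sineWeight n 0 := by
  unfold sineWeight
  set θ := Real.pi / ((n : ℝ) + 1)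
  rw [show (((1 : ℕ) : ℝ) + 1) * θ = 2 * θ by push_cast; ring, Real.sin_two_mul]
  simp only [Nat.cast_zero, zero_add, one_mul]
  ring

theorem sineWeight_add_add (n j : ℕ) :
    sineWeight n j + sineWeight n (j + 1) + sineWeight n (j + 2)
      = (1 + 2 * Real.cos (Real.pi / ((n : ℝ) + 1))) * sineWeight n (j + 1) := by
  unfold sineWeight
  set θ := Real.pi / ((n : ℝ) + 1)
  push_cast
  rw [show ((j : ℝ) + 1) * θ = ((j : ℝ) + 1 + 1) * θ - θ by ring,
    show ((j : ℝ) + 2 + 1) * θ = ((j : ℝ) + 1 + 1) * θ + θ by ring, Real.sin_sub, Real.sin_add]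
  ring

theorem closedBallMass_one_sineWeight {n : ℕ} (x : Fin n) :
    closedBallMass (SimpleGraph.pathGraph n) (fun y => sineWeight n y) x 1
      = (1 + 2 * Real.cos (Real.pi / ((n : ℝ) + 1))) * sineWeight n x := by
  rw [closedBallMass_pathGraph (f := sineWeight n) (fun _ => rfl)]
  obtain ⟨x, hx⟩ := x
  simp only
  -- Since the sine vanishes at index n, truncation at the right end is harmless.
  have hlast : ∀ m, m ≤ x → ∑ j ∈ Finset.Ico m (min (x + 1 + 1) n), sineWeight n j
      = ∑ j ∈ Finset.Ico m (x + 2), sineWeight n j := by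
    intro m hm
    rcases (show n = x + 1 ∨ x + 2 ≤ n by omega) with h | h
    · rw [Finset.sum_Ico_succ_top (by omega), min_eq_right (by omega), ← h, sineWeight_last,
        add_zero]
    · rw [min_eq_left (by omega)]
  rw [hlast _ (by omega)]
  cases x with
  | zero => simp [Finset.sum_range_succ, sineWeight_zero_add_one]
  | succ x =>
    rw [Nat.add_sub_cancel, ← sineWeight_add_add, Finset.sum_Ico_succ_top (by omega),
      Finset.sum_Ico_succ_top (by omega), Finset.sum_Ico_succ_top (by omega), Finset.Ico_self,
      Finset.sum_empty, zero_add]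

/-- From sin 4θ − sin 2θ = 2 cos 3θ sin θ it suffices that cos 3θ ≤ 1/2, which holds for π/9 ≤ θ ≤
π/2. -/
theorem sineWeight_three_le {n : ℕ} (h1 : 1 ≤ n) (h8 : n ≤ 8) :
    sineWeight n 3 ≤ sineWeight n 0 + sineWeight n 1 := by
  have h1' : (1 : ℝ) ≤ n := by exact_mod_cast h1
  have h8' : (n : ℝ) ≤ 8 := by exact_mod_cast h8
  have hs : 0 < sineWeight n 0 := sineWeight_pos h1
  have hn : (0 : ℝ) < (n : ℝ) + 1 := by positivity
  have hpi := Real.pi_pos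
  have hθ1 : Real.pi / 9 ≤ Real.pi / ((n : ℝ) + 1) := by gcongr; linarith
  have hθ2 : Real.pi / ((n : ℝ) + 1) ≤ Real.pi / 2 := by gcongr; linarith
  unfold sineWeight at *
  set θ := Real.pi / ((n : ℝ) + 1)
  simp only [Nat.cast_zero, zero_add, one_mul] at *
  push_cast
  have hcos : Real.cos (3 * θ) ≤ 1 / 2 := by
    rw [← Real.cos_pi_div_three]
    rcases le_total (3 * θ) Real.pi with h | h
    · exact Real.cos_le_cos_of_nonneg_of_le_pi (by positivity) h (by linarith)
    · rw [← Real.cos_two_pi_sub]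
      exact Real.cos_le_cos_of_nonneg_of_le_pi (by positivity) (by linarith) (by linarith)
  have e : Real.sin ((3 + 1) * θ) = Real.sin ((1 + 1) * θ) + 2 * Real.cos (3 * θ) * Real.sin θ := by
    rw [show (3 + 1) * θ = 3 * θ + θ by ring, show (1 + 1) * θ = 3 * θ - θ by ring, Real.sin_add,
      Real.sin_sub]
    ring
  rw [e]
  nlinarith

theorem one_lt_two_mul_cos_three_mul {n : ℕ} (h : 9 ≤ n) :
    1 < 2 * Real.cos (3 * (Real.pi / ((n : ℝ) + 1))) := by
  have h' : (9 : ℝ) ≤ n := by exact_mod_cast h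
  have hpi := Real.pi_pos
  have hθ : Real.pi / ((n : ℝ) + 1) < Real.pi / 9 := by gcongr; linarith
  have := Real.cos_lt_cos_of_nonneg_of_le_pi (x := 3 * (Real.pi / ((n : ℝ) + 1)))
    (y := Real.pi / 3) (by positivity) (by linarith) (by linarith)
  rw [Real.cos_pi_div_three] at this
  linarith

/-- The doubling inequalities for a symmetric unimodal eigenvector `a` on at most eight vertices
with `a 3 ≤ a 0 + a 1`. -/
theorem sum_Ico_le_of_le_eight {n : ℕ} (h1 : 1 ≤ n) (h8 : n ≤ 8) {a : ℕ → ℝ} {c : ℝ}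
    (hpos : ∀ j, j < n → 0 < a j) (hsymm : ∀ i j, i + j + 1 = n → a i = a j)
    (hmono : ∀ i j, i ≤ j → 2 * j + 1 ≤ n → a i ≤ a j) (h3 : a 3 ≤ a 0 + a 1)
    (hlast : a n = 0)
    (hzero : a 0 + a 1 = c * a 0) (hadd : ∀ j, a j + a (j + 1) + a (j + 2) = c * a (j + 1))
    {x k : ℕ} (hx : x < n) (hk : 1 ≤ k) (hk3 : k ≤ 3) :
    ∑ j ∈ Finset.Ico (x - (2 * k + 1)) (min (x + (2 * k + 1) + 1) n), a j
      ≤ c * ∑ j ∈ Finset.Ico (x - k) (min (x + k + 1) n), a j := by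
  have hs : ∀ i, i < n → a i = a (n - 1 - i) := fun i hi => hsymm i _ (by omega)
  -- Symmetry folds all weights onto indices at most 3, so these relations and `hzero` eliminate
  -- every product of c with a weight, leaving linear inequalities.
  have e0 := hadd 0
  have e1 := hadd 1
  have e2 := hadd 2
  interval_cases n
  · have p0 := hpos 0 (by norm_num)
    interval_cases x <;> interval_cases k <;>
      (norm_num [Finset.sum_Ico_eq_sum_range, Finset.sum_range_succ, mul_add]; linarith)
  · have s1 := hs 1 (by norm_num)
    have p0 := hpos 0 (by norm_num)
    norm_num at s1
    norm_num [s1] at hzero e0 e1 e2 h3 hlast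
    interval_cases x <;> interval_cases k <;>
      norm_num [Finset.sum_Ico_eq_sum_range, Finset.sum_range_succ, mul_add, s1] <;> linarith
  · have s2 := hs 2 (by norm_num)
    have p0 := hpos 0 (by norm_num)
    have m0 := hmono 0 1 (by norm_num) (by norm_num)
    norm_num at s2
    norm_num [s2] at hzero e0 e1 e2 h3 hlast
    interval_cases x <;> interval_cases k <;>
      norm_num [Finset.sum_Ico_eq_sum_range, Finset.sum_range_succ, mul_add, s2] <;> linarith
  · have s2 := hs 2 (by norm_num)
    have s3 := hs 3 (by norm_num)
    have p0 := hpos 0 (by norm_num)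
    have m0 := hmono 0 1 (by norm_num) (by norm_num)
    norm_num at s2 s3
    norm_num [s3, s2] at hzero e0 e1 e2 h3 hlast
    interval_cases x <;> interval_cases k <;>
      norm_num [Finset.sum_Ico_eq_sum_range, Finset.sum_range_succ, mul_add, s3, s2] <;> linarith
  · have s3 := hs 3 (by norm_num)
    have s4 := hs 4 (by norm_num)
    have p0 := hpos 0 (by norm_num)
    have m0 := hmono 0 1 (by norm_num) (by norm_num)
    have m1 := hmono 1 2 (by norm_num) (by norm_num)
    norm_num at s3 s4
    norm_num [s4, s3] at hzero e0 e1 e2 h3 hlast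
    interval_cases x <;> interval_cases k <;>
      norm_num [Finset.sum_Ico_eq_sum_range, Finset.sum_range_succ, mul_add, s4, s3] <;> linarith
  · have s3 := hs 3 (by norm_num)
    have s4 := hs 4 (by norm_num)
    have s5 := hs 5 (by norm_num)
    have p0 := hpos 0 (by norm_num)
    have m0 := hmono 0 1 (by norm_num) (by norm_num)
    have m1 := hmono 1 2 (by norm_num) (by norm_num)
    norm_num at s3 s4 s5
    norm_num [s5, s4, s3] at hzero e0 e1 e2 h3 hlast
    interval_cases x <;> interval_cases k <;>
      norm_num [Finset.sum_Ico_eq_sum_range, Finset.sum_range_succ, mul_add, s5, s4, s3] <;> linarith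
  · have s4 := hs 4 (by norm_num)
    have s5 := hs 5 (by norm_num)
    have s6 := hs 6 (by norm_num)
    have p0 := hpos 0 (by norm_num)
    have m0 := hmono 0 1 (by norm_num) (by norm_num)
    have m1 := hmono 1 2 (by norm_num) (by norm_num)
    have m2 := hmono 2 3 (by norm_num) (by norm_num)
    norm_num at s4 s5 s6
    norm_num [s6, s5, s4] at hzero e0 e1 e2 h3 hlast
    interval_cases x <;> interval_cases k <;>
      norm_num [Finset.sum_Ico_eq_sum_range, Finset.sum_range_succ, mul_add, s6, s5, s4] <;> linarith
  · have s4 := hs 4 (by norm_num)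
    have s5 := hs 5 (by norm_num)
    have s6 := hs 6 (by norm_num)
    have s7 := hs 7 (by norm_num)
    have p0 := hpos 0 (by norm_num)
    have m0 := hmono 0 1 (by norm_num) (by norm_num)
    have m1 := hmono 1 2 (by norm_num) (by norm_num)
    have m2 := hmono 2 3 (by norm_num) (by norm_num)
    norm_num at s4 s5 s6 s7
    norm_num [s7, s6, s5, s4] at hzero e0 e1 e2 h3 hlast
    interval_cases x <;> interval_cases k <;>
      norm_num [Finset.sum_Ico_eq_sum_range, Finset.sum_range_succ, mul_add, s7, s6, s5, s4] <;> linarith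

/-! ### Bounds for the two constants of the path. -/

theorem eigenvalue_pathGraph_lt_three (n : ℕ) :
    1 + 2 * Real.cos (Real.pi / ((n : ℝ) + 1)) < 3 := by
  have hpi := Real.pi_pos
  have h := Real.cos_lt_cos_of_nonneg_of_le_pi (x := 0) (y := Real.pi / ((n : ℝ) + 1)) le_rfl
    (div_le_self hpi.le (by linarith [(Nat.cast_nonneg n : (0 : ℝ) ≤ n)])) (by positivity)
  rw [Real.cos_zero] at h
  linarith

theorem le_doublingConst₀_pathGraph {n : ℕ} (hn : 1 ≤ n) {μ : Fin n → ℝ} (hμ : ∀ v, 0 < μ v) :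
    1 + 2 * Real.cos (Real.pi / ((n : ℝ) + 1))
      ≤ doublingConst₀ (SimpleGraph.pathGraph n) μ := by
  have : Nonempty (Fin n) := ⟨⟨0, hn⟩⟩
  exact eigenvalue_le_of_closedBallMass_one_le (fun v => sineWeight_pos v.2)
    closedBallMass_one_sineWeight hμ (closedBallMass_one_le_doublingConst₀_mul hμ)

theorem le_doublingConst_pathGraph {n : ℕ} (hn : 1 ≤ n) {μ : Fin n → ℝ} (hμ : ∀ v, 0 < μ v) :
    1 + 2 * Real.cos (Real.pi / ((n : ℝ) + 1))
      ≤ doublingConst (SimpleGraph.pathGraph n) μ := by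
  have : Nonempty (Fin n) := ⟨⟨0, hn⟩⟩
  refine eigenvalue_le_of_closedBallMass_one_le (fun v => sineWeight_pos v.2)
    closedBallMass_one_sineWeight hμ fun x => ?_
  have h := closedBallMass_le_doublingConst_mul (G := SimpleGraph.pathGraph n) hμ x 0
  rwa [closedBallMass_zero (SimpleGraph.pathGraph_preconnected n)] at h

theorem leastDoublingConst₀_pathGraph {n : ℕ} (hn : 1 ≤ n) :
    leastDoublingConst₀ (SimpleGraph.pathGraph n)
      = 1 + 2 * Real.cos (Real.pi / ((n : ℝ) + 1)) := by
  have : Nonempty (Fin n) := ⟨⟨0, hn⟩⟩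
  have hs : ∀ v : Fin n, 0 < sineWeight n v := fun v => sineWeight_pos v.2
  exact le_antisymm ((leastDoublingConst₀_le hs).trans
      (doublingConst₀_le hs fun x => (closedBallMass_one_sineWeight x).le))
    (le_leastDoublingConst₀ fun μ hμ => le_doublingConst₀_pathGraph hn hμ)

theorem leastDoublingConst_pathGraph_lt_three {n : ℕ} (hn : 1 ≤ n) :
    leastDoublingConst (SimpleGraph.pathGraph n) < 3 := by
  have : Nonempty (Fin n) := ⟨⟨0, hn⟩⟩
  have hnpos : (0 : ℝ) < n := by exact_mod_cast hn
  have hs : ∀ v : Fin n, 0 < sineWeight n v := fun v => sineWeight_pos v.2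
  -- The sine part has mass at most n, so ε adds at most 1/2, within the slack 1 of the uniform
  -- measure for k ≥ 1. At k = 0 the strictness comes from the eigenvalue being below 3.
  set ε : ℝ := 1 / (2 * n)
  have hε : 0 < ε := by positivity
  have hμ : ∀ v : Fin n, 0 < (1 : ℝ) + ε * sineWeight n v := fun v =>
    add_pos one_pos (mul_pos hε (hs v))
  refine (leastDoublingConst_le hμ).trans_lt (doublingConst_lt hμ fun x k => ?_)
  rw [closedBallMass_add_smul (fun _ => 1) (fun v : Fin n => sineWeight n v),
    closedBallMass_add_smul (fun _ => 1) (fun v : Fin n => sineWeight n v)]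
  have h1 := closedBallMass_pathGraph_one_le x k
  rcases Nat.eq_zero_or_pos k with rfl | hk
  · rw [if_pos rfl, add_zero] at h1
    have h2 := closedBallMass_one_sineWeight x
    have h3 : closedBallMass (SimpleGraph.pathGraph n) (fun y => sineWeight n y) x 1
        < 3 * closedBallMass (SimpleGraph.pathGraph n) (fun y => sineWeight n y) x 0 := by
      rw [h2, closedBallMass_zero (SimpleGraph.pathGraph_preconnected n)]
      exact mul_lt_mul_of_pos_right (eigenvalue_pathGraph_lt_three n) (hs x)
    have h4 := mul_lt_mul_of_pos_left h3 hε
    simp only [mul_zero, zero_add] at *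
    linarith
  · rw [if_neg hk.ne'] at h1
    have h2 : closedBallMass (SimpleGraph.pathGraph n) (fun y => sineWeight n y) x (2 * k + 1)
        ≤ n := by
      refine (closedBallMass_le_sum (fun v => (hs v).le) x _).trans ?_
      calc ∑ y : Fin n, sineWeight n y ≤ ∑ _y : Fin n, (1 : ℝ) :=
            Finset.sum_le_sum fun y _ => sineWeight_le_one n y
        _ = n := by simp
    have h3 : ε * closedBallMass (SimpleGraph.pathGraph n) (fun y => sineWeight n y) x (2 * k + 1)
        ≤ 1 / 2 := by
      calc _ ≤ ε * n := mul_le_mul_of_nonneg_left h2 hε.le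
        _ = 1 / 2 := by simp only [ε]; field_simp
    have h4 := mul_pos hε
      (closedBallMass_pos (G := SimpleGraph.pathGraph n) hs x k)
    linarith

theorem leastDoublingConst_pathGraph_le {n : ℕ} (h1 : 1 ≤ n) (h8 : n ≤ 8) :
    leastDoublingConst (SimpleGraph.pathGraph n)
      ≤ 1 + 2 * Real.cos (Real.pi / ((n : ℝ) + 1)) := by
  have : Nonempty (Fin n) := ⟨⟨0, h1⟩⟩
  have hs : ∀ v : Fin n, 0 < sineWeight n v := fun v => sineWeight_pos v.2
  have hθ : 0 ≤ Real.cos (Real.pi / ((n : ℝ) + 1)) := by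
    have hpi := Real.pi_pos
    have h1' : (1 : ℝ) ≤ n := by exact_mod_cast h1
    refine Real.cos_nonneg_of_neg_pi_div_two_le_of_le ?_ (by gcongr; linarith)
    have : 0 ≤ Real.pi / ((n : ℝ) + 1) := by positivity
    linarith
  refine (leastDoublingConst_le hs).trans (doublingConst_le hs fun x k => ?_)
  have small : ∀ l, 1 ≤ l → l ≤ 3 →
      closedBallMass (SimpleGraph.pathGraph n) (fun y => sineWeight n y) x (2 * l + 1)
        ≤ (1 + 2 * Real.cos (Real.pi / ((n : ℝ) + 1)))
          * closedBallMass (SimpleGraph.pathGraph n) (fun y => sineWeight n y) x l := by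
    intro l hl hl3
    rw [closedBallMass_pathGraph (f := sineWeight n) (fun _ => rfl),
      closedBallMass_pathGraph (f := sineWeight n) (fun _ => rfl)]
    exact sum_Ico_le_of_le_eight h1 h8 (fun j => sineWeight_pos) (fun i j => sineWeight_symm)
      (fun i j => sineWeight_mono) (sineWeight_three_le h1 h8) (sineWeight_last n)
      (sineWeight_zero_add_one n) (sineWeight_add_add n) x.2 hl hl3
  rcases Nat.eq_zero_or_pos k with rfl | hk
  · rw [closedBallMass_zero (SimpleGraph.pathGraph_preconnected n)]
    exact (closedBallMass_one_sineWeight x).le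
  rcases le_total k 3 with hk3 | hk3
  · exact small k hk hk3
  -- Radius 7 already covers a path of at most eight vertices, so larger k only enlarges the
  -- denominator.
  · calc closedBallMass (SimpleGraph.pathGraph n) (fun y => sineWeight n y) x (2 * k + 1)
        = closedBallMass (SimpleGraph.pathGraph n) (fun y => sineWeight n y) x (2 * 3 + 1) := by
          rw [closedBallMass_pathGraph (f := sineWeight n) (fun _ => rfl),
            closedBallMass_pathGraph (f := sineWeight n) (fun _ => rfl)]
          have := x.2
          congr 2 <;> omega
      _ ≤ _ := small 3 (by norm_num) le_rfl
      _ ≤ _ := mul_le_mul_of_nonneg_left (closedBallMass_mono (fun v => (hs v).le) x hk3)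
          (by linarith)

theorem lt_leastDoublingConst_pathGraph {n : ℕ} (h9 : 9 ≤ n) :
    1 + 2 * Real.cos (Real.pi / ((n : ℝ) + 1))
      < leastDoublingConst (SimpleGraph.pathGraph n) := by
  have : Nonempty (Fin n) := ⟨⟨0, by omega⟩⟩
  refine lt_of_le_of_ne (le_leastDoublingConst fun μ hμ =>
    le_doublingConst_pathGraph (by omega) hμ) fun heq => ?_
  obtain ⟨ν, ⟨hν0, hν1⟩, hν⟩ :=
    exists_mem_stdSimplex_closedBallMass_le (G := SimpleGraph.pathGraph n)
  rw [← heq] at hν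
  have hc := one_lt_two_mul_cos_three_mul h9
  rw [Real.cos_three_mul] at hc
  set θ := Real.pi / ((n : ℝ) + 1)
  have hle : ∀ x, closedBallMass (SimpleGraph.pathGraph n) ν x 1 ≤ (1 + 2 * Real.cos θ) * ν x := by
    intro x
    have h := hν x 0
    rwa [closedBallMass_zero (SimpleGraph.pathGraph_preconnected n)] at h
  have heig := closedBallMass_one_eq_of_le (fun v : Fin n => sineWeight_pos v.2)
    closedBallMass_one_sineWeight hle
  let f : ℕ → ℝ := fun j => if h : j < n then ν ⟨j, h⟩ else 0
  have hf : ∀ y : Fin n, ν y = f y := fun y => by simp [f]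
  have hf0 : 0 < f 0 := by
    have hn0 : 0 < n := by omega
    rw [show f 0 = ν ⟨0, hn0⟩ from dif_pos hn0]
    -- At a zero of a nonnegative eigenvector the unit ball has mass zero, so a zero at the endpoint
    -- spreads along the whole path, against total mass 1.
    refine lt_of_le_of_ne (hν0 _) fun h0 => ?_
    have hzero : ∀ j (hj : j < n), ν ⟨j, hj⟩ = 0 := by
      intro j
      induction j with
      | zero => exact fun _ => h0.symm
      | succ j ih =>
        intro hj
        have h := heig ⟨j, by omega⟩
        rw [ih, mul_zero] at h
        refine le_antisymm (h ▸ apply_le_closedBallMass hν0 ?_) (hν0 _)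
        rw [pathGraph_dist_le_iff]
        simp only
        omega
    rw [Finset.sum_eq_zero fun (y : Fin n) _ => hzero y y.2] at hν1
    exact zero_ne_one hν1
  have e0 := heig ⟨0, by omega⟩
  have e1 := heig ⟨1, by omega⟩
  have e2 := heig ⟨2, by omega⟩
  -- The endpoint test: the eigenvector relations turn it into 4 cos³ θ − 3 cos θ ≤ 1/2,
  -- contradicting `hc`.
  have hv := hν ⟨0, by omega⟩ 1
  rw [closedBallMass_pathGraph hf] at e0 e1 e2 hv
  rw [closedBallMass_pathGraph hf] at hv
  rw [hf] at e0 e1 e2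
  rw [min_eq_left (by simp only; omega)] at e0 e1 e2 hv
  rw [min_eq_left (by simp only; omega)] at hv
  norm_num [Finset.sum_Ico_eq_sum_range, Finset.sum_range_succ] at e0 e1 e2 hv
  have h1 : f 1 = 2 * Real.cos θ * f 0 := by linarith
  have h2 : f 2 = (4 * Real.cos θ ^ 2 - 1) * f 0 := by
    rw [h1] at e1
    linarith
  have h3 : f 3 = (8 * Real.cos θ ^ 3 - 4 * Real.cos θ) * f 0 := by
    rw [h1, h2] at e2
    linarith
  rw [h1, h2, h3] at hv
  nlinarith [mul_lt_mul_of_pos_right hc hf0]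

end GraphDoubling

end

theorem theorem6p6 (n : ℕ) (hn : 1 ≤ n) :
    GraphDoubling.leastDoublingConst₀ (SimpleGraph.pathGraph n)
        = 1 + 2 * Real.cos (Real.pi / ((n : ℝ) + 1)) ∧
    1 + 2 * Real.cos (Real.pi / ((n : ℝ) + 1))
        ≤ GraphDoubling.leastDoublingConst (SimpleGraph.pathGraph n) ∧
    GraphDoubling.leastDoublingConst (SimpleGraph.pathGraph n) < 3 ∧
    (GraphDoubling.leastDoublingConst₀ (SimpleGraph.pathGraph n)
        = GraphDoubling.leastDoublingConst (SimpleGraph.pathGraph n) ↔ n ≤ 8) := by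
  have hle := GraphDoubling.le_leastDoublingConst (G := SimpleGraph.pathGraph n)
    fun μ hμ => GraphDoubling.le_doublingConst_pathGraph hn hμ
  refine ⟨GraphDoubling.leastDoublingConst₀_pathGraph hn, hle,
    GraphDoubling.leastDoublingConst_pathGraph_lt_three hn, ?_⟩
  rw [GraphDoubling.leastDoublingConst₀_pathGraph hn]
  constructor
  · intro h
    by_contra! h9
    exact (GraphDoubling.lt_leastDoublingConst_pathGraph h9).ne h
  · exact fun h8 => le_antisymm hle (GraphDoubling.leastDoublingConst_pathGraph_le hn h8)
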